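/- A fort of a finite simple graph $G$ is a nonempty set $F$ of vertices such that every vertex outside $F$ is adjacent to either zero or at least two vertices of $F$; a fort is minimal if no proper subset of it is a fort. Let $\mathcal{F}_{T_n}$ and $\mathcal{F}_{R_n}$ denote the maximum number of minimal forts over all trees, respectively over all forests, on $n$ vertices, and let $\mathcal{F}_{P_n}$ denote the number of minimal forts of the path on $n$ vertices. Then for every $n \ge 3$, $$\mathcal{F}_{T_n} \le \mathcal{F}_{R_n} \le \binom{n}{2}\,\mathcal{F}_{P_n}.$$ Moreover, the numbers $\mathcal{F}_{P_n}$ satisfy $\mathcal{F}_{P_1} = \mathcal{F}_{P_2} = \mathcal{F}_{P_3} = 1$ and $\mathcal{F}_{P_n} = \mathcal{F}_{P_{n-2}} + \mathcal{F}_{P_{n-3}}$ for all $n \ge 4$. -/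

import Mathlib

namespace MinimalForts

/-- A fort of a graph: a nonempty set `F` of vertices such that every vertex outside `F` is
adjacent to either zero or at least two vertices of `F`. -/
def IsFort {V : Type*} (G : SimpleGraph V) (F : Set V) : Prop :=
  F.Nonempty ∧ ∀ v, v ∉ F →
    (G.neighborSet v ∩ F).ncard = 0 ∨ 2 ≤ (G.neighborSet v ∩ F).ncard

/-- The number of minimal forts (minimal with respect to inclusion) of a finite graph. -/
noncomputable def numMinimalForts {V : Type*} [Finite V] (G : SimpleGraph V) : ℕ :=
  {F : Set V | Minimal (IsFort G) F}.ncard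

/-- The numbers of minimal forts of the trees on `n` vertices. -/
def treeCounts (n : ℕ) : Set ℕ :=
  {k | ∃ G : SimpleGraph (Fin n), G.IsTree ∧ numMinimalForts G = k}

/-- The numbers of minimal forts of the forests on `n` vertices. -/
def forestCounts (n : ℕ) : Set ℕ :=
  {k | ∃ G : SimpleGraph (Fin n), G.IsAcyclic ∧ numMinimalForts G = k}

/-- The maximum number of minimal forts over all trees on `n` vertices. -/
noncomputable def maxTree (n : ℕ) : ℕ := sSup (treeCounts n)

/-- The maximum number of minimal forts over all forests on `n` vertices. -/
noncomputable def maxForest (n : ℕ) : ℕ := sSup (forestCounts n)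

/-- The number of minimal forts of the path on `n` vertices. -/
noncomputable def pathCount (n : ℕ) : ℕ := numMinimalForts (SimpleGraph.pathGraph n)

theorem finite_treeCounts (n : ℕ) : (treeCounts n).Finite :=
  (Set.finite_range fun G : SimpleGraph (Fin n) => numMinimalForts G).subset
    (by rintro k ⟨G, -, rfl⟩; exact ⟨G, rfl⟩)

theorem finite_forestCounts (n : ℕ) : (forestCounts n).Finite :=
  (Set.finite_range fun G : SimpleGraph (Fin n) => numMinimalForts G).subset
    (by rintro k ⟨G, -, rfl⟩; exact ⟨G, rfl⟩)

/-- For `n ≥ 1` the supremum in `maxTree` is an attained maximum. -/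
theorem isGreatest_maxTree {n : ℕ} (hn : 1 ≤ n) : IsGreatest (treeCounts n) (maxTree n) := by
  have : Nonempty (Fin n) := ⟨⟨0, hn⟩⟩
  obtain ⟨T, -, hT⟩ := (SimpleGraph.connected_top (V := Fin n)).exists_isTree_le
  have hne : (treeCounts n).Nonempty := ⟨_, T, hT, rfl⟩
  exact ⟨Nat.sSup_mem hne (finite_treeCounts n).bddAbove,
    fun _ hk => le_csSup (finite_treeCounts n).bddAbove hk⟩

/-- The supremum in `maxForest` is an attained maximum. -/
theorem isGreatest_maxForest (n : ℕ) : IsGreatest (forestCounts n) (maxForest n) := by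
  have hne : (forestCounts n).Nonempty := ⟨_, ⊥, SimpleGraph.isAcyclic_bot, rfl⟩
  exact ⟨Nat.sSup_mem hne (finite_forestCounts n).bddAbove,
    fun _ hk => le_csSup (finite_forestCounts n).bddAbove hk⟩

end MinimalForts

namespace MinimalForts

/-! Let `r` be the plastic number, the growth rate of the path recurrence. In a forest on `n`
vertices at most `r ^ (n - 1)` minimal forts contain a given vertex (`ncard_minimal_mem_le`), and `r
^ (n - 1)` is at most twice the path count. A minimal fort with two or more vertices is counted at
least twice when these bounds are summed over the vertices; this yields `n` times the path count,
and `n ≤ n.choose 2` for `n ≥ 3`.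

For the bound at a vertex `x`, cut an edge `xy`. Minimality is not inherited by the two pieces, so
minimal forts are replaced by tight forts, whose local conditions do survive the cut. Sorting them
by their behaviour at the root (isolated, matched, pending) gives recursive inequalities for three
counts. `GraftTree` records the cuts as a rooted tree, and `counts_le` bounds the recursion by
induction on that tree.

On the path, a minimal fort contains both ends and consists of runs of length one or two separated
by single gaps. Removing the first run and its gap gives the recurrence. -/

theorem exists_plastic : ∃ r : ℝ, r ^ 3 = r + 1 ∧ 1.32 ≤ r ∧ r ≤ 1.33 := by
  have hc : ContinuousOn (fun r : ℝ => r ^ 3 - r) (Set.Icc 1.32 1.33) := by fun_prop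
  obtain ⟨r, hr, h⟩ := intermediate_value_Icc (by norm_num) hc
    (show (1 : ℝ) ∈ Set.Icc _ _ by constructor <;> norm_num)
  exact ⟨r, by simp only at h; linarith, hr.1, hr.2⟩

/-! ### Growth of the grafting recursion -/

/-- Rooted trees, built from single vertices by grafting: `graft t s` makes the root of `s` a
new child of the root of `t`. -/
inductive GraftTree
  | leaf : GraftTree
  | graft : GraftTree → GraftTree → GraftTree

namespace GraftTree

def size : GraftTree → ℕ
  | leaf => 1
  | graft t s => t.size + s.size

/-- The triple `(k, b, z)`: `k` and `b` count the minimal forts through the root in which the root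
has no, respectively one, neighbour; `z` counts the sets that become minimal forts when a new
vertex, belonging to the fort, is attached to the root, the root not belonging to the fort. -/
def counts : GraftTree → ℕ × ℕ × ℕ
  | leaf => (1, 0, 0)
  | graft t s =>
    (t.counts.1 * s.counts.2.2, t.counts.2.1 * s.counts.2.2 + t.counts.1 * s.counts.1,
      t.counts.2.2 + (s.counts.1 + s.counts.2.1))

theorem one_le_size (t : GraftTree) : 1 ≤ t.size := by
  induction t with
  | leaf => exact le_rfl
  | graft t s ht _ => exact ht.trans (Nat.le_add_right _ _)

theorem eq_leaf_of_size {t : GraftTree} (h : t.size ≤ 1) : t = leaf := by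
  cases t with
  | leaf => rfl
  | graft t s =>
    have := t.one_le_size
    have := s.one_le_size
    simp only [size] at h
    omega

theorem eq_graft_of_size {t : GraftTree} (h : t.size = 2) : t = graft leaf leaf := by
  cases t with
  | leaf => simp [size] at h
  | graft t s =>
    have := t.one_le_size
    have := s.one_le_size
    simp only [size] at h
    rw [eq_leaf_of_size (t := t) (by omega), eq_leaf_of_size (t := s) (by omega)]

theorem counts_of_size_le_three {t : GraftTree} (h : t.size ≤ 3) :
    t.size = 1 ∧ t.counts = (1, 0, 0) ∨ t.size = 2 ∧ t.counts = (0, 1, 1) ∨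
      t.size = 3 ∧ t.counts = (1, 0, 1) ∨ t.size = 3 ∧ t.counts = (0, 0, 2) := by
  cases t with
  | leaf => simp [size, counts]
  | graft t s =>
    have ht := t.one_le_size
    have hs := s.one_le_size
    simp only [size] at h
    rcases Nat.lt_or_ge t.size 2 with h1 | h1
    · obtain rfl := eq_leaf_of_size (t := t) (by omega)
      rcases Nat.lt_or_ge s.size 2 with h2 | h2
      · obtain rfl := eq_leaf_of_size (t := s) (by omega)
        simp [size, counts]
      · simp only [size] at h
        obtain rfl := eq_graft_of_size (t := s) (by omega)
        simp [size, counts]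
    · obtain rfl := eq_graft_of_size (t := t) (by omega)
      simp only [size] at h
      obtain rfl := eq_leaf_of_size (t := s) (by omega)
      simp [size, counts]

/-- The growth condition on the triple of counts of a rooted tree of size `n`, where `X = r ^ n`. -/
def CountBound (r k b z X : ℝ) : Prop :=
  z + k ≤ X ∧ r * (k + b) ≤ X ∧ k + b + z ≤ r * X

section

variable {r k b z X k' b' z' Y : ℝ}

/-- The second inequality of `CountBound` reproduces itself with the help of the first, since the
new sum is at most `(k + b) * (z' + k')`. -/
theorem graft_mul_le (hr : 0 ≤ r) (hk : 0 ≤ k) (hb : 0 ≤ b) (hk' : 0 ≤ k')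
    (hz' : 0 ≤ z') (h : CountBound r k b z X) (h' : CountBound r k' b' z' Y) :
    r * (k * z' + (b * z' + k * k')) ≤ X * Y := by
  obtain ⟨-, h2, -⟩ := h
  obtain ⟨h1', -, -⟩ := h'
  have : 0 ≤ r * (k + b) := by positivity
  calc _ ≤ (r * (k + b)) * (z' + k') := by
        have : 0 ≤ r * (b * k') := by positivity
        linarith
    _ ≤ X * Y := by gcongr; linarith

/-- Grafting adds some terms where the target `X * Y` is a product; for large pieces a product
dominates a sum, which leaves enough slack. -/
theorem graft_large (hr : r ^ 3 = r + 1) (h1 : 1.32 ≤ r) (hk : 0 ≤ k) (hb : 0 ≤ b)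
    (hk' : 0 ≤ k') (hz' : z' = 0 ∨ 1 ≤ z')
    (h : CountBound r k b z X) (h' : CountBound r k' b' z' Y) (hX : r ^ 4 ≤ X) (hY : 2 ≤ Y) :
    z + (k' + b') + k * z' ≤ X * Y ∧
      k * z' + (b * z' + k * k') + (z + (k' + b')) ≤ r * (X * Y) := by
  obtain ⟨t1, t2, t3⟩ := h
  obtain ⟨s1, s2, s3⟩ := h'
  have r0 : 0 ≤ r := by linarith
  have r4 : r ^ 4 = r * (r + 1) := by linear_combination r * hr
  -- With `X = r * a` the second inequality reads `k + b ≤ a`, and `r ^ 4 = r * (r + 1)` gives `a ≥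
  -- 2`. Hence `(a - 1) * (Y - 1) ≥ 1`, that is `a + Y ≤ a * Y`.
  obtain ⟨a, rfl⟩ : ∃ a, X = r * a := ⟨X / r, by field_simp⟩
  have ha : 2 ≤ a := by
    refine le_of_mul_le_mul_left (a := r) ?_ (by linarith)
    rw [r4] at hX
    exact (mul_le_mul_of_nonneg_left (by linarith) r0).trans hX
  have hab : a + Y ≤ a * Y := by nlinarith
  have t2' : k + b ≤ a := le_of_mul_le_mul_left t2 (by linarith)
  have hrab : r * (a + Y) ≤ r * (a * Y) := mul_le_mul_of_nonneg_left hab r0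
  constructor
  · rcases hz' with rfl | hz'
    · linarith
    · have e1 : k * (z' - 1) ≤ a * (z' - 1) := by gcongr; linarith
      have e2 : (a - 1) * z' ≤ (a - 1) * Y := by gcongr <;> linarith
      have e3 : (r - 1) * (a + Y) ≤ (r - 1) * (a * Y) := by gcongr; linarith
      linarith
  · have e0 : k * z' + (b * z' + k * k') ≤ (k + b) * (z' + k') := by
      have : 0 ≤ b * k' := by positivity
      linarith
    have e1 : (k + b) * (z' + k' - 1) ≤ a * (Y - 1) := by
      rcases le_total 1 (z' + k') with h | h
      · gcongr
      · exact (mul_nonpos_of_nonneg_of_nonpos (by positivity) (by linarith)).trans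
          (mul_nonneg (by linarith) (by linarith))
    refine le_of_mul_le_mul_left (a := r) ?_ (by linarith)
    have e2 : r * (r * (r * a * Y)) = (r + 1) * (a * Y) := by linear_combination (a * Y) * hr
    have e3 : r * (r * (r * a)) = (r + 1) * a := by linear_combination a * hr
    have e4 := mul_le_mul_of_nonneg_left t3 r0
    have e5 := mul_le_mul_of_nonneg_left e1 r0
    have e6 := mul_le_mul_of_nonneg_left e0 r0
    linarith

/-- Below size four the product estimate fails, so the possible triples are checked one by one.
Grafting onto a single vertex turns `k' + b' + z'` into the new `z + k`; this is why `CountBound`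
needs its third inequality. -/
theorem graft_onto_small (hr : r ^ 3 = r + 1) (h1 : 1.32 ≤ r) (h' : CountBound r k' b' z' Y)
    (hY : r ≤ Y) (hk' : 0 ≤ k') (hb' : 0 ≤ b')
    (ht : (X = r ∧ k = 1 ∧ b = 0 ∧ z = 0) ∨ (X = r ^ 2 ∧ k = 0 ∧ b = 1 ∧ z = 1) ∨
      (X = r ^ 3 ∧ k = 1 ∧ b = 0 ∧ z = 1) ∨ (X = r ^ 3 ∧ k = 0 ∧ b = 0 ∧ z = 2)) :
    z + (k' + b') + k * z' ≤ X * Y ∧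
      k * z' + (b * z' + k * k') + (z + (k' + b')) ≤ r * (X * Y) := by
  obtain ⟨s1, s2, s3⟩ := h'
  have r2 : 1.74 ≤ r ^ 2 := by nlinarith
  have r0 : 0 ≤ r := by linarith
  have hs : 1.32 * (k' + b') ≤ Y := (mul_le_mul_of_nonneg_right h1 (by positivity)).trans s2
  have hrY : 1.32 * Y ≤ r * Y := by gcongr; linarith
  have hr2Y : 1.74 * Y ≤ r ^ 2 * Y := by gcongr; linarith
  have r3Y : r ^ 3 * Y = r * Y + Y := by rw [hr]; ring
  have r4Y : r ^ 4 * Y = r ^ 2 * Y + r * Y := by linear_combination (r * Y) * hr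
  rcases ht with ⟨rfl, rfl, rfl, rfl⟩ | ⟨rfl, rfl, rfl, rfl⟩ | ⟨rfl, rfl, rfl, rfl⟩ |
    ⟨rfl, rfl, rfl, rfl⟩
  · refine ⟨by linarith, ?_⟩
    refine le_of_mul_le_mul_left (a := X) ?_ (by linarith)
    have := mul_le_mul_of_nonneg_left s1 r0
    linarith
  all_goals constructor <;> linarith

theorem graft_small (hr : r ^ 3 = r + 1) (h1 : 1.32 ≤ r) (h : CountBound r k b z X)
    (hX : r ^ 4 ≤ X) (hk : 0 ≤ k) (hb : 0 ≤ b)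
    (hs : (Y = r ∧ k' = 1 ∧ b' = 0 ∧ z' = 0) ∨ (Y = r ^ 2 ∧ k' = 0 ∧ b' = 1 ∧ z' = 1)) :
    z + (k' + b') + k * z' ≤ X * Y ∧
      k * z' + (b * z' + k * k') + (z + (k' + b')) ≤ r * (X * Y) := by
  obtain ⟨t1, t2, t3⟩ := h
  have r2 : 1.74 ≤ r ^ 2 := by nlinarith
  have r4 : r ^ 4 = r ^ 2 + r := by linear_combination r * hr
  have r0 : 0 ≤ X := by linarith
  have h0 : 1.32 * (k + b) ≤ X := (mul_le_mul_of_nonneg_right h1 (by positivity)).trans t2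
  have hrX : 1.32 * X ≤ r * X := by gcongr
  have hr2X : 1.74 * X ≤ r ^ 2 * X := by gcongr
  have r3X : r ^ 3 * X = r * X + X := by rw [hr]; ring
  -- From `r ^ 5 - r ^ 4 - 1 = (r ^ 3 - r - 1) * (r ^ 2 - r + 1)`. It pays for the extra `1`
  -- contributed by the small grafted tree.
  have hr4 : r ^ 4 * (r - 1) = 1 := by linear_combination (r ^ 2 - r + 1) * hr
  have hX1 : 1 ≤ X * (r - 1) := hr4.symm.trans_le (by gcongr; linarith)
  rcases hs with ⟨rfl, rfl, rfl, rfl⟩ | ⟨rfl, rfl, rfl, rfl⟩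
  all_goals constructor <;> linarith

end

theorem counts_le {r : ℝ} (hr : r ^ 3 = r + 1) (h1 : 1.32 ≤ r) (t : GraftTree) :
    CountBound r t.counts.1 t.counts.2.1 t.counts.2.2 (r ^ t.size) := by
  have r2 : 1.74 ≤ r ^ 2 := by nlinarith
  have large (m : ℕ) (u : GraftTree) (hu : m ≤ u.size) : r ^ m ≤ r ^ u.size :=
    pow_le_pow_right₀ (by linarith) hu
  induction t with
  | leaf =>
    simp only [CountBound, counts, size, pow_one, Nat.cast_one, Nat.cast_zero]
    exact ⟨by linarith, by linarith, by nlinarith⟩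
  | graft t s ht hs =>
    have key := graft_mul_le (by linarith) (by positivity) (by positivity) (by positivity)
      (by positivity) ht hs
    suffices h : _ ∧ _ by
      simp only [CountBound, counts, size, pow_add]
      push_cast
      exact ⟨h.1, key, h.2⟩
    rcases Nat.lt_or_ge t.size 4 with hts | hts
    · refine graft_onto_small hr h1 hs (by simpa using large 1 s s.one_le_size)
        (by positivity) (by positivity) ?_
      rcases counts_of_size_le_three (t := t) (by omega) with ⟨h, hc⟩ | ⟨h, hc⟩ | ⟨h, hc⟩ | ⟨h, hc⟩
        <;> simp [h, hc]
    rcases Nat.lt_or_ge s.size 3 with hss | hss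
    · refine graft_small hr h1 ht (large 4 t hts) (by positivity) (by positivity) ?_
      rcases counts_of_size_le_three (t := s) (by omega) with ⟨h, hc⟩ | ⟨h, hc⟩ | ⟨h, hc⟩ | ⟨h, hc⟩
      · simp [h, hc]
      · simp [h, hc]
      all_goals omega
    · refine graft_large hr h1 (by positivity) (by positivity) (by positivity) ?_ ht hs
        (large 4 t hts) (le_trans (by linarith) (large 3 s hss))
      rcases Nat.eq_zero_or_pos s.counts.2.2 with h0 | h0
      · exact .inl (by exact_mod_cast h0)
      · exact .inr (by exact_mod_cast h0)

end GraftTree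
-- Cutting a forest at an edge
section Bridges

variable {V : Type*} {G G' : SimpleGraph V} {x y r : V} {Y F : Set V}

/-- `xy` is an edge of `G` whose deletion leaves `G'`, and `Y` is a set of vertices containing `y`
but not `x` that no other edge of `G` leaves. -/
structure IsCut (G G' : SimpleGraph V) (x y : V) (Y : Set V) : Prop where
  adj : G.Adj x y
  right_mem : y ∈ Y
  left_notMem : x ∉ Y
  eq_of_adj : ∀ p ∈ Y, ∀ q ∉ Y, G.Adj p q → p = y ∧ q = x
  adj_iff : ∀ a b, G'.Adj a b ↔ G.Adj a b ∧ ¬(a = x ∧ b = y) ∧ ¬(a = y ∧ b = x)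

theorem IsCut.symm (h : IsCut G G' x y Y) : IsCut G G' y x Yᶜ where
  adj := h.adj.symm
  right_mem := h.left_notMem
  left_notMem := fun hy => hy h.right_mem
  eq_of_adj p hp q hq hpq :=
    (h.eq_of_adj q (not_not.1 hq) p hp hpq.symm).symm
  adj_iff a b := by rw [h.adj_iff]; tauto

theorem exists_isCut (hG : G.IsAcyclic) (h : G.Adj x y) :
    ∃ Y, IsCut G (G.deleteEdges {s(x, y)}) x y Y := by
  have hb := SimpleGraph.isAcyclic_iff_forall_adj_isBridge.1 hG h
  rw [SimpleGraph.isBridge_iff] at hb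
  have hadj (a b : V) : (G.deleteEdges {s(x, y)}).Adj a b ↔
      G.Adj a b ∧ ¬(a = x ∧ b = y) ∧ ¬(a = y ∧ b = x) := by
    simp [SimpleGraph.deleteEdges_adj, not_or]
  refine ⟨{w | (G.deleteEdges {s(x, y)}).Reachable y w}, h, SimpleGraph.Reachable.refl _,
    fun hx => ?_, fun p hp q hq hpq => ?_, hadj⟩
  · exact hb hx.symm
  · by_contra hne
    have hpx : p ≠ x := by
      rintro rfl
      exact hb hp.symm
    exact hq (SimpleGraph.Reachable.trans hp ((hadj p q).2 ⟨hpq, by tauto, by tauto⟩).reachable)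

/-- The local structure of the minimal forts of a forest, except at the vertex `x`: a vertex outside
`F` has no or exactly two neighbours in `F`, a vertex of `F` has at most one, and `F` does not split
into parts that are neither adjacent nor have a common neighbour outside `F`. -/
structure IsTightFort (G : SimpleGraph V) (x : V) (F : Set V) : Prop where
  eq_or_eq : ∀ v ∉ F, v ≠ x → ∀ a ∈ F, G.Adj v a →
    ∃ b ∈ F, b ≠ a ∧ G.Adj v b ∧ ∀ c ∈ F, G.Adj v c → c = a ∨ c = b
  eq_of_adj : ∀ v ∈ F, ∀ a ∈ F, ∀ b ∈ F, G.Adj v a → G.Adj v b → a = b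
  eq_of_closed : ∀ A ⊆ F, A.Nonempty → (∀ v ∈ A, ∀ w ∈ F, G.Adj v w → w ∈ A) →
    (∀ v ∈ A, ∀ w ∉ F, ∀ u ∈ F, G.Adj v w → G.Adj w u → u ∈ A) → A = F

/-- Only `y` can lose a neighbour on its side of the cut, so it becomes the exempt vertex.
Indecomposability survives because any link between the two sides of `F` passes through the edge
`xy`. -/
theorem IsTightFort.inter (hY : IsCut G G' x y Y) (hF : IsTightFort G r F) (hr : r = x ∨ r = y)
    (hxy : x ∈ F ∨ y ∈ F) : IsTightFort G' y (F ∩ Y) := by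
  obtain ⟨h1, h2, h3⟩ := hF
  obtain ⟨c1, c2, c3, c4, c5⟩ := hY
  refine ⟨?_, ?_, ?_⟩
  · rintro v hv hvy a ⟨haF, haY⟩ hva
    have hvY : v ∈ Y := by
      by_contra hvY
      have := c4 a haY v hvY ((c5 _ _).1 hva).1.symm
      grind
    have hvF : v ∉ F := fun h => hv ⟨h, hvY⟩
    have hvr : v ≠ r := by grind
    obtain ⟨b, hb, hba, hvb, hc⟩ := h1 v hvF hvr a haF ((c5 _ _).1 hva).1
    have hbY : b ∈ Y := by
      by_contra hbY
      exact hvy (c4 v hvY b hbY hvb).1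
    exact ⟨b, ⟨hb, hbY⟩, hba, (c5 _ _).2 ⟨hvb, by grind⟩,
      fun c hcF hvc => hc c hcF.1 ((c5 _ _).1 hvc).1⟩
  · intro v hv a ha b hb hva hvb
    exact h2 v hv.1 a ha.1 b hb.1 ((c5 _ _).1 hva).1 ((c5 _ _).1 hvb).1
  · intro A hA hne k1 k2
    have e : ∀ p ∈ Y, ∀ q ∈ Y, G.Adj p q → G'.Adj p q := by
      intro p hp q hq h
      exact (c5 p q).2 ⟨h, by grind⟩
    have hAF : ∀ v ∈ A, v ∈ F ∧ v ∈ Y := fun v hv => hA hv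
    by_cases hP : y ∈ A ∨ ∃ v ∈ A, G.Adj v y
    · have hyA : y ∈ F → y ∈ A := by
        rintro hy
        rcases hP with h | ⟨v, hv, hvy⟩
        · exact h
        · exact k1 v hv y ⟨hy, c2⟩ (e _ (hAF v hv).2 _ c2 hvy)
      -- A closed part touching `y` stays closed once all of the far side is added, so the union is
      -- `F`.
      have := h3 (A ∪ (F ∩ Yᶜ)) (by grind) (hne.mono Set.subset_union_left) ?_ ?_
      · ext v
        constructor
        · exact fun h => hA h
        · rintro ⟨hvF, hvY⟩
          rw [← this] at hvF
          exact hvF.resolve_right fun h => h.2 hvY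
      · rintro v (hv | ⟨hvF, hvY⟩) w hw hvw
        · by_cases hwY : w ∈ Y
          · exact .inl (k1 v hv w ⟨hw, hwY⟩ (e _ (hAF v hv).2 _ hwY hvw))
          · exact .inr ⟨hw, hwY⟩
        · by_cases hwY : w ∈ Y
          · obtain ⟨rfl, rfl⟩ := c4 w hwY v hvY hvw.symm
            exact .inl (hyA hw)
          · exact .inr ⟨hw, hwY⟩
      · rintro v hv w hw u hu hvw hwu
        by_cases huY : u ∈ Y
        swap
        · exact .inr ⟨hu, huY⟩
        left
        by_cases hwY : w ∈ Y
        · rcases hv with hv | ⟨hvF, hvY⟩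
          · exact k2 v hv w (fun h => hw h.1) u ⟨hu, huY⟩ (e _ (hAF v hv).2 _ hwY hvw)
              (e _ hwY _ huY hwu)
          · obtain ⟨rfl, rfl⟩ := c4 w hwY v hvY hvw.symm
            rcases hP with h | ⟨v', hv', h⟩
            · exact absurd (hAF _ h).1 hw
            · exact k2 v' hv' w (fun h => hw h.1) u ⟨hu, huY⟩ (e _ (hAF v' hv').2 _ hwY h)
                (e _ hwY _ huY hwu)
        · obtain ⟨rfl, rfl⟩ := c4 u huY w hwY hwu.symm
          exact hyA hu
    · push Not at hP
      -- A part away from `y` has no link across the cut, so it would be all of `F`, which contains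
      -- `x` or `y`.
      have := h3 A (fun v hv => (hAF v hv).1) hne ?_ ?_
      · rw [← this] at hxy
        rcases hxy with h | h
        · exact absurd (hAF _ h).2 c3
        · exact absurd h hP.1
      · intro v hv w hw hvw
        by_cases hwY : w ∈ Y
        · exact k1 v hv w ⟨hw, hwY⟩ (e _ (hAF v hv).2 _ hwY hvw)
        · obtain ⟨rfl, rfl⟩ := c4 v (hAF v hv).2 w hwY hvw
          exact absurd hv hP.1
      · intro v hv w hw u hu hvw hwu
        have hvY := (hAF v hv).2
        by_cases hwY : w ∈ Y
        · by_cases huY : u ∈ Y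
          · exact k2 v hv w (fun h => hw h.1) u ⟨hu, huY⟩ (e _ hvY _ hwY hvw) (e _ hwY _ huY hwu)
          · obtain ⟨rfl, rfl⟩ := c4 w hwY u huY hwu
            exact absurd hvw (hP.2 v hv)
        · obtain ⟨rfl, rfl⟩ := c4 v hvY w hwY hvw
          exact absurd hv hP.1

theorem IsTightFort.of_notMem (hY : IsCut G G' x y Y) (hF : IsTightFort G r F) (hx : x ∉ F)
    (hy : y ∉ F) : IsTightFort G' r F := by
  have e (p q : V) (hp : p ∈ F) : G'.Adj p q ↔ G.Adj p q := by
    rw [hY.adj_iff]; grind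
  have e' (p q : V) (hp : p ∈ F) : G'.Adj q p ↔ G.Adj q p := by
    rw [G'.adj_comm, e p q hp, G.adj_comm]
  obtain ⟨h1, h2, h3⟩ := hF
  refine ⟨by grind, by grind, fun A hA hne k1 k2 => h3 A hA hne ?_ ?_⟩
  · intro v hv w hw hvw
    exact k1 v hv w hw ((e _ _ (hA hv)).2 hvw)
  · intro v hv w hw u hu hvw hwu
    exact k2 v hv w hw u hu ((e _ _ (hA hv)).2 hvw) ((e' _ _ hu).2 hwu)

/-- Tight forts through `x` in which `x` has no neighbour. -/
def isolatedForts (G : SimpleGraph V) (x : V) : Set (Set V) :=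
  {F | IsTightFort G x F ∧ x ∈ F ∧ ∀ a ∈ F, ¬G.Adj x a}

/-- Tight forts through `x` in which `x` has a neighbour. -/
def matchedForts (G : SimpleGraph V) (x : V) : Set (Set V) :=
  {F | IsTightFort G x F ∧ x ∈ F ∧ ∃ a ∈ F, G.Adj x a}

/-- Tight forts avoiding `x` in which `x` has exactly one neighbour. -/
def pendingForts (G : SimpleGraph V) (x : V) : Set (Set V) :=
  {F | IsTightFort G x F ∧ x ∉ F ∧ ∃ a ∈ F, G.Adj x a ∧ ∀ b ∈ F, G.Adj x b → b = a}

theorem inter_mem_pendingForts (hY : IsCut G G' x y Y) (hF : IsTightFort G x F) (hx : x ∈ F)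
    (hy : y ∉ F) : F ∩ Y ∈ pendingForts G' y := by
  refine ⟨hF.inter hY (.inl rfl) (.inl hx), fun h => hy h.1, ?_⟩
  obtain ⟨c1, c2, c3, c4, c5⟩ := hY
  obtain ⟨b, hb, hbx, hyb, hc⟩ := hF.eq_or_eq y hy c1.ne.symm x hx c1.symm
  have hbY : b ∈ Y := by
    by_contra hbY
    exact hbx (c4 y c2 b hbY hyb).2
  refine ⟨b, ⟨hb, hbY⟩, (c5 _ _).2 ⟨hyb, by grind⟩, fun c hcF hyc => ?_⟩
  rcases hc c hcF.1 ((c5 _ _).1 hyc).1 with rfl | h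
  · exact absurd hcF.2 c3
  · exact h

theorem mem_of_isolatedForts (hY : IsCut G G' x y Y) (hF : F ∈ isolatedForts G x) :
    F ∩ Yᶜ ∈ isolatedForts G' x ∧ F ∩ Y ∈ pendingForts G' y := by
  obtain ⟨hF, hx, ha⟩ := hF
  have hy : y ∉ F := fun h => ha y h hY.adj
  refine ⟨⟨hF.inter hY.symm (.inr rfl) (.inr hx), ⟨hx, hY.left_notMem⟩, fun a h hxa => ?_⟩,
    inter_mem_pendingForts hY hF hx hy⟩
  exact ha a h.1 ((hY.adj_iff _ _).1 hxa).1

/-- The unique partner of `x` is either `y`, whose removal isolates both ends, or lies on the side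
of `x`, and then `y` is outside `F` and loses one of its two neighbours. -/
theorem mem_of_matchedForts (hY : IsCut G G' x y Y) (hF : F ∈ matchedForts G x) :
    (F ∩ Yᶜ ∈ matchedForts G' x ∧ F ∩ Y ∈ pendingForts G' y) ∨
      (F ∩ Yᶜ ∈ isolatedForts G' x ∧ F ∩ Y ∈ isolatedForts G' y) := by
  obtain ⟨hF, hx, a, ha, hxa⟩ := hF
  have hX := hF.inter hY.symm (.inr rfl) (.inr hx)
  by_cases hy : y ∈ F
  · right
    refine ⟨⟨hX, ⟨hx, hY.left_notMem⟩, fun b hb hxb => ?_⟩,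
      ⟨hF.inter hY (.inl rfl) (.inl hx), ⟨hy, hY.right_mem⟩, fun b hb hyb => ?_⟩⟩
    · have := hF.eq_of_adj x hx b hb.1 y hy ((hY.adj_iff _ _).1 hxb).1 hY.adj
      exact hb.2 (this ▸ hY.right_mem)
    · have := hF.eq_of_adj y hy b hb.1 x hx ((hY.adj_iff _ _).1 hyb).1 hY.adj.symm
      exact hY.left_notMem (this ▸ hb.2)
  · left
    refine ⟨⟨hX, ⟨hx, hY.left_notMem⟩, a, ⟨ha, fun haY => ?_⟩, (hY.adj_iff _ _).2 ⟨hxa, ?_⟩⟩,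
      inter_mem_pendingForts hY hF hx hy⟩
    · exact hy ((hY.eq_of_adj a haY x hY.left_notMem hxa.symm).1 ▸ ha)
    · grind

theorem mem_of_pendingForts (hY : IsCut G G' x y Y) (hF : F ∈ pendingForts G x) :
    F ∈ pendingForts G' x ∨ F ∈ isolatedForts G' y ∨ F ∈ matchedForts G' y := by
  obtain ⟨hF, hx, a, ha, hxa, hu⟩ := hF
  by_cases hy : y ∈ F
  · right
    obtain rfl : y = a := hu y hy hY.adj
    -- Since `y` is the only neighbour of `x` in `F`, nothing links `F ∩ Y` to the other side, so
    -- `F` lies in `Y`.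
    have hFY : F ∩ Y = F := by
      refine hF.eq_of_closed _ Set.inter_subset_left ⟨y, hy, hY.right_mem⟩ ?_ ?_
      · rintro v ⟨hv, hvY⟩ w hw hvw
        refine ⟨hw, ?_⟩
        by_contra hwY
        exact hx ((hY.eq_of_adj v hvY w hwY hvw).2 ▸ hw)
      · rintro v ⟨hv, hvY⟩ w hw u huF hvw hwu
        refine ⟨huF, ?_⟩
        by_cases hwY : w ∈ Y
        · by_contra huY
          exact hw ((hY.eq_of_adj w hwY u huY hwu).1 ▸ hy)
        · obtain ⟨rfl, rfl⟩ := hY.eq_of_adj v hvY w hwY hvw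
          rw [hu u huF hwu]
          exact hvY
    have := hF.inter hY (.inl rfl) (.inr hy)
    rw [hFY] at this
    by_cases h : ∃ b ∈ F, G'.Adj y b
    · exact .inr ⟨this, hy, h⟩
    · exact .inl ⟨this, hy, by simpa using h⟩
  · left
    refine ⟨hF.of_notMem hY hx hy, hx, a, ha, (hY.adj_iff _ _).2 ⟨hxa, by grind⟩,
      fun b hb hxb => hu b hb ((hY.adj_iff _ _).1 hxb).1⟩

variable [Finite V]

theorem ncard_le_of_forall_inter {S : Set (Set V)} {T : Set (Set V × Set V)} (Y : Set V)
    (h : ∀ F ∈ S, (F ∩ Yᶜ, F ∩ Y) ∈ T) : S.ncard ≤ T.ncard := by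
  refine Set.ncard_le_ncard_of_injOn (fun F => (F ∩ Yᶜ, F ∩ Y)) h (fun F _ F' _ hFF' => ?_)
    T.toFinite
  simp only [Prod.mk.injEq] at hFF'
  rw [← Set.inter_union_compl F Y, hFF'.1, hFF'.2, Set.inter_union_compl]

theorem ncard_isolatedForts_le (hY : IsCut G G' x y Y) :
    (isolatedForts G x).ncard ≤ (isolatedForts G' x).ncard * (pendingForts G' y).ncard := by
  rw [← Set.ncard_prod]
  exact ncard_le_of_forall_inter Y fun F hF => mem_of_isolatedForts hY hF

theorem ncard_matchedForts_le (hY : IsCut G G' x y Y) :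
    (matchedForts G x).ncard ≤ (matchedForts G' x).ncard * (pendingForts G' y).ncard +
      (isolatedForts G' x).ncard * (isolatedForts G' y).ncard := by
  rw [← Set.ncard_prod, ← Set.ncard_prod]
  exact (ncard_le_of_forall_inter Y fun F hF => mem_of_matchedForts hY hF).trans
    (Set.ncard_union_le _ _)

theorem ncard_pendingForts_le (hY : IsCut G G' x y Y) :
    (pendingForts G x).ncard ≤ (pendingForts G' x).ncard +
      ((isolatedForts G' y).ncard + (matchedForts G' y).ncard) :=
  (Set.ncard_le_ncard (fun _ hF => mem_of_pendingForts hY hF) (Set.toFinite _)).trans <|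
    (Set.ncard_union_le _ _).trans <| Nat.add_le_add_left (Set.ncard_union_le _ _) _

/-- The vertex type stays fixed while edges are deleted; `C` serves only to bound the size, being
divided between the two recursive calls. The count recursion is monotone, so upper bounds propagate.
-/
theorem exists_graftTree (hG : G.IsAcyclic) {C : Set V} (hx : x ∈ C)
    (hC : ∀ v ∈ C, ∀ w, G.Adj v w → w ∈ C) :
    ∃ t : GraftTree, t.size ≤ C.ncard ∧ (isolatedForts G x).ncard ≤ t.counts.1 ∧
      (matchedForts G x).ncard ≤ t.counts.2.1 ∧ (pendingForts G x).ncard ≤ t.counts.2.2 := by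
  induction G using WellFoundedLT.induction generalizing x C with
  | ind G ih =>
    by_cases hy : ∃ y, G.Adj x y
    · obtain ⟨y, hxy⟩ := hy
      obtain ⟨Y, hY⟩ := exists_isCut hG hxy
      generalize hG' : G.deleteEdges {s(x, y)} = G' at hY
      have hle : G' ≤ G := hG' ▸ SimpleGraph.deleteEdges_le _
      have hlt : G' < G := lt_of_le_of_ne hle fun h => by
        have := (hY.adj_iff x y).1 (h ▸ hxy)
        tauto
      have hac := hG.anti hle
      obtain ⟨t, t0, t1, t2, t3⟩ := ih G' hlt hac (x := x) (C := C ∩ Yᶜ) ⟨hx, hY.left_notMem⟩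
        fun v hv w hvw => ⟨hC v hv.1 w (hle hvw), fun hwY => by
          have := hY.eq_of_adj w hwY v hv.2 (hle hvw).symm
          have := (hY.adj_iff _ _).1 hvw
          tauto⟩
      obtain ⟨s, s0, s1, s2, s3⟩ := ih G' hlt hac (x := y) (C := C ∩ Y) ⟨hC x hx y hxy, hY.right_mem⟩
        fun v hv w hvw => ⟨hC v hv.1 w (hle hvw), by
          by_contra hwY
          have := hY.eq_of_adj v hv.2 w hwY (hle hvw)
          have := (hY.adj_iff _ _).1 hvw
          tauto⟩
      refine ⟨.graft t s, ?_, (ncard_isolatedForts_le hY).trans (Nat.mul_le_mul t1 s3),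
        (ncard_matchedForts_le hY).trans (Nat.add_le_add (Nat.mul_le_mul t2 s3)
          (Nat.mul_le_mul t1 s1)), (ncard_pendingForts_le hY).trans
          (Nat.add_le_add t3 (Nat.add_le_add s1 s2))⟩
      have := Set.ncard_inter_add_ncard_sdiff_eq_ncard C Y (Set.toFinite _)
      rw [Set.sdiff_eq] at this
      simp only [GraftTree.size]
      omega
    · push Not at hy
      refine ⟨.leaf, (Set.ncard_pos (Set.toFinite C)).2 ⟨x, hx⟩, ?_, ?_, ?_⟩
      · refine (Set.ncard_le_one_iff_subset_singleton (Set.toFinite _)).2 ⟨{x}, fun F hF => ?_⟩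
        obtain ⟨hF, hxF, -⟩ := hF
        refine (hF.eq_of_closed {x} (by simpa using hxF) (Set.singleton_nonempty x) ?_ ?_).symm
        all_goals
          rintro v rfl w _
          simp [hy]
      · refine ((Set.ncard_eq_zero (Set.toFinite _)).2 (Set.eq_empty_of_forall_notMem ?_)).le
        rintro F ⟨-, -, a, -, h⟩
        exact hy a h
      · refine ((Set.ncard_eq_zero (Set.toFinite _)).2 (Set.eq_empty_of_forall_notMem ?_)).le
        rintro F ⟨-, -, a, -, h, -⟩
        exact hy a h

/-! ### Minimal forts of a forest are tight -/

theorem isFort_iff : IsFort G F ↔ F.Nonempty ∧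
    ∀ v ∉ F, ∀ a ∈ F, G.Adj v a → ∃ b ∈ F, b ≠ a ∧ G.Adj v b := by
  refine and_congr_right fun _ => forall₂_congr fun v _ => ?_
  constructor
  · intro h a ha hva
    have hmem : a ∈ G.neighborSet v ∩ F := ⟨hva, ha⟩
    rcases h with h | h
    · rw [Set.ncard_eq_zero] at h
      simp [h] at hmem
    · obtain ⟨b, hb, hba⟩ := Set.exists_ne_of_one_lt_ncard h a
      exact ⟨b, hb.2, hba, hb.1⟩
  · intro h
    rcases Set.eq_empty_or_nonempty (G.neighborSet v ∩ F) with h0 | ⟨a, hva, ha⟩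
    · exact .inl (by rw [h0, Set.ncard_empty])
    · obtain ⟨b, hb, hba, hvb⟩ := h a ha hva
      exact .inr ((Set.one_lt_ncard (Set.toFinite _)).2 ⟨a, ⟨hva, ha⟩, b, ⟨hvb, hb⟩, hba.symm⟩)

/-- Two branches at `v` suffice: `v` itself sees `a` and `b`, and any other outside vertex seeing a
fort vertex of a branch lies in that branch, with its second neighbour there too. -/
theorem isFort_inter_union (hF : IsFort G F) {v a b : V} {A B : Set V} {GA GB : SimpleGraph V}
    (hA : IsCut G GA v a A) (hB : IsCut G GB v b B) (ha : a ∈ F) (hb : b ∈ F) (hab : a ≠ b) :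
    IsFort G (F ∩ (A ∪ B)) := by
  rw [isFort_iff] at hF ⊢
  refine ⟨⟨a, ha, .inl hA.right_mem⟩, fun w hw c hc hwc => ?_⟩
  by_cases hwv : w = v
  · subst hwv
    by_cases hca : c = a
    · exact ⟨b, ⟨hb, .inr hB.right_mem⟩, hca ▸ hab.symm, hB.adj⟩
    · exact ⟨a, ⟨ha, .inl hA.right_mem⟩, Ne.symm hca, hA.adj⟩
  · have key {D : Set V} {d : V} {GD : SimpleGraph V} (hD : IsCut G GD v d D) (hd : d ∈ F)
        (hDD : D ⊆ A ∪ B) (hcD : c ∈ D) : ∃ e ∈ F ∩ (A ∪ B), e ≠ c ∧ G.Adj w e := by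
      have hwD : w ∈ D := by
        by_contra h
        exact hwv (hD.eq_of_adj c hcD w h hwc.symm).2
      have hwF : w ∉ F := fun h => hw ⟨h, hDD hwD⟩
      obtain ⟨e, he, hec, hwe⟩ := hF.2 w hwF c hc.1 hwc
      refine ⟨e, ⟨he, hDD ?_⟩, hec, hwe⟩
      by_contra heD
      exact hwF ((hD.eq_of_adj w hwD e heD hwe).1 ▸ hd)
    rcases hc.2 with h | h
    · exact key hA ha Set.subset_union_left h
    · exact key hB hb Set.subset_union_right h

theorem isTightFort_of_minimal (hG : G.IsAcyclic) (hF : Minimal (IsFort G) F) (x : V) :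
    IsTightFort G x F := by
  have key {v a b : V} (ha : a ∈ F) (hb : b ∈ F) (hab : a ≠ b) (hva : G.Adj v a)
      (hvb : G.Adj v b) : v ∉ F ∧ ∀ c ∈ F, G.Adj v c → c = a ∨ c = b := by
    obtain ⟨A, hA⟩ := exists_isCut hG hva
    obtain ⟨B, hB⟩ := exists_isCut hG hvb
    -- By minimality `F` lies within the two branches, which leaves no room for `v` or for a third
    -- neighbour.
    have hsub := hF.2 (isFort_inter_union hF.1 hA hB ha hb hab) Set.inter_subset_left
    refine ⟨fun hv => (hsub hv).2.elim hA.left_notMem hB.left_notMem, fun c hc hvc => ?_⟩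
    rcases (hsub hc).2 with h | h
    · exact .inl (hA.eq_of_adj c h v hA.left_notMem hvc.symm).1
    · exact .inr (hB.eq_of_adj c h v hB.left_notMem hvc.symm).1
  have hfort := isFort_iff.1 hF.1
  refine ⟨fun v hv _ a ha hva => ?_, fun v hv a ha b hb hva hvb => ?_, fun A hA hne h1 h2 => ?_⟩
  · obtain ⟨b, hb, hba, hvb⟩ := hfort.2 v hv a ha hva
    exact ⟨b, hb, hba, hvb, (key ha hb hba.symm hva hvb).2⟩
  · by_contra hab
    exact (key ha hb hab hva hvb).1 hv
  · refine Set.Subset.antisymm hA (hF.2 (isFort_iff.2 ⟨hne, fun v hv a ha hva => ?_⟩) hA)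
    have hvF : v ∉ F := fun h => hv (h1 a ha v h hva.symm)
    obtain ⟨b, hb, hba, hvb⟩ := hfort.2 v hvF a (hA ha) hva
    exact ⟨b, h2 a ha v hvF b hb hva.symm hvb, hba, hvb⟩

theorem ncard_minimal_mem_le {ρ : ℝ} (hρ : ρ ^ 3 = ρ + 1) (h1 : 1.32 ≤ ρ) (hG : G.IsAcyclic)
    (x : V) : ρ * ({F | Minimal (IsFort G) F ∧ x ∈ F}.ncard : ℝ) ≤ ρ ^ Nat.card V := by
  obtain ⟨t, t0, t1, t2, -⟩ := exists_graftTree hG (Set.mem_univ x) fun _ _ _ _ => Set.mem_univ _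
  rw [Set.ncard_univ] at t0
  have hsub : {F | Minimal (IsFort G) F ∧ x ∈ F} ⊆ isolatedForts G x ∪ matchedForts G x := by
    rintro F ⟨hF, hx⟩
    have := isTightFort_of_minimal hG hF x
    by_cases h : ∃ a ∈ F, G.Adj x a
    · exact .inr ⟨this, hx, h⟩
    · exact .inl ⟨this, hx, by simpa using h⟩
  have hle : ({F | Minimal (IsFort G) F ∧ x ∈ F}.ncard : ℝ) ≤ t.counts.1 + t.counts.2.1 := by
    exact_mod_cast (Set.ncard_le_ncard hsub (Set.toFinite _)).trans
      ((Set.ncard_union_le _ _).trans (Nat.add_le_add t1 t2))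
  calc _ ≤ ρ * (t.counts.1 + t.counts.2.1 : ℝ) := by gcongr
    _ ≤ ρ ^ t.size := (GraftTree.counts_le hρ h1 t).2.1
    _ ≤ ρ ^ Nat.card V := pow_le_pow_right₀ (by linarith) t0

end Bridges
-- Minimal forts of the path
/-- The sets of positions in a path on the vertices `0, …, n - 1` that contain both ends, do not miss
two consecutive positions and do not contain three consecutive positions. -/
def pathSets (n : ℕ) : Set (Set ℕ) :=
  {F | F ⊆ Set.Iio n ∧ 0 ∈ F ∧ n - 1 ∈ F ∧ (∀ i, i + 1 < n → i ∈ F ∨ i + 1 ∈ F) ∧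
    ∀ i, i ∈ F → i + 1 ∈ F → i + 2 ∉ F}

theorem finite_pathSets (n : ℕ) : (pathSets n).Finite :=
  (Set.finite_Iio n).finite_subsets.subset fun _ hF => hF.1

/-- Shifts `F` by two and prepends a member followed by a gap. -/
def gapOne (F : Set ℕ) : Set ℕ := {i | i = 0 ∨ ∃ j ∈ F, i = j + 2}

/-- Shifts `F` by three and prepends two members followed by a gap. -/
def gapTwo (F : Set ℕ) : Set ℕ := {i | i = 0 ∨ i = 1 ∨ ∃ j ∈ F, i = j + 3}

theorem gapOne_injective : Function.Injective gapOne := by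
  intro F F' h
  ext i
  have : i + 2 ∈ gapOne F ↔ i + 2 ∈ gapOne F' := by rw [h]
  simpa [gapOne] using this

theorem gapTwo_injective : Function.Injective gapTwo := by
  intro F F' h
  ext i
  have : i + 3 ∈ gapTwo F ↔ i + 3 ∈ gapTwo F' := by rw [h]
  simpa [gapTwo] using this

theorem gapOne_mem_pathSets {n : ℕ} (hn : 1 ≤ n) {F : Set ℕ} (hF : F ∈ pathSets n) :
    gapOne F ∈ pathSets (n + 2) := by
  obtain ⟨h1, h2, h3, h4, h5⟩ := hF
  refine ⟨?_, .inl rfl, .inr ⟨n - 1, h3, by omega⟩, ?_, ?_⟩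
  · rintro i (rfl | ⟨j, hj, rfl⟩)
    · simp
    · simpa using h1 hj
  · rintro (_ | _ | i) hi
    · exact .inl (.inl rfl)
    · exact .inr (.inr ⟨0, h2, rfl⟩)
    · exact (h4 i (by omega)).imp (fun h => .inr ⟨i, h, rfl⟩) (fun h => .inr ⟨i + 1, h, rfl⟩)
  · simp only [gapOne, Set.mem_ofPred_eq]
    grind

theorem gapTwo_mem_pathSets {n : ℕ} (hn : 1 ≤ n) {F : Set ℕ} (hF : F ∈ pathSets n) :
    gapTwo F ∈ pathSets (n + 3) := by
  obtain ⟨h1, h2, h3, h4, h5⟩ := hF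
  refine ⟨?_, .inl rfl, .inr (.inr ⟨n - 1, h3, by omega⟩), ?_, ?_⟩
  · rintro i (rfl | rfl | ⟨j, hj, rfl⟩)
    · simp
    · simp
    · simpa using h1 hj
  · rintro (_ | _ | _ | i) hi
    · exact .inl (.inl rfl)
    · exact .inl (.inr (.inl rfl))
    · exact .inr (.inr (.inr ⟨0, h2, rfl⟩))
    · exact (h4 i (by omega)).imp (fun h => .inr (.inr ⟨i, h, rfl⟩))
        (fun h => .inr (.inr ⟨i + 1, h, rfl⟩))
  · simp only [gapTwo, Set.mem_ofPred_eq]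
    grind

theorem shift_mem_pathSets {n k : ℕ} (hn : 1 ≤ n) {F : Set ℕ} (hF : F ∈ pathSets (n + k))
    (hk : k ∈ F) : {i | i + k ∈ F} ∈ pathSets n := by
  obtain ⟨h1, h2, h3, h4, h5⟩ := hF
  refine ⟨fun i hi => by simpa using h1 hi, by simpa using hk, ?_, fun i hi => ?_, fun i a b c => ?_⟩
  · rwa [Set.mem_ofPred_eq, show n - 1 + k = n + k - 1 by omega]
  · simpa [add_right_comm] using h4 (i + k) (by omega)
  · simp only [Set.mem_ofPred_eq, add_right_comm] at a b c
    exact h5 _ a b c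

/-- The two images correspond to a first run of length one or two, that is, to whether position `1`
is present. -/
theorem pathSets_add_three {n : ℕ} (hn : 1 ≤ n) :
    pathSets (n + 3) = gapOne '' pathSets (n + 1) ∪ gapTwo '' pathSets n := by
  ext F
  constructor
  · intro hF
    obtain ⟨h1, h2, h3, h4, h5⟩ := id hF
    by_cases h : 1 ∈ F
    · have h6 : 2 ∉ F := h5 0 h2 h
      have h7 : 3 ∈ F := (h4 2 (by omega)).resolve_left h6
      refine .inr ⟨_, shift_mem_pathSets hn hF h7, ?_⟩
      ext i
      rcases i with _ | _ | _ | i <;> simp [gapTwo, h2, h, h6]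
    · have h6 : 2 ∈ F := (h4 1 (by omega)).resolve_left h
      refine .inl ⟨_, shift_mem_pathSets (n := n + 1) (by omega) hF h6, ?_⟩
      ext i
      rcases i with _ | _ | i <;> simp [gapOne, h2, h]
  · rintro (⟨F, hF, rfl⟩ | ⟨F, hF, rfl⟩)
    · exact gapOne_mem_pathSets (by omega) hF
    · exact gapTwo_mem_pathSets hn hF

theorem ncard_pathSets_add_three {n : ℕ} (hn : 1 ≤ n) :
    (pathSets (n + 3)).ncard = (pathSets (n + 1)).ncard + (pathSets n).ncard := by
  rw [pathSets_add_three hn, Set.ncard_union_eq ?_ ((finite_pathSets _).image _)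
    ((finite_pathSets _).image _), Set.ncard_image_of_injective _ gapOne_injective,
    Set.ncard_image_of_injective _ gapTwo_injective]
  rw [Set.disjoint_left]
  rintro _ ⟨F, -, rfl⟩ ⟨F', -, h⟩
  have : 1 ∈ gapOne F := h ▸ .inr (.inl rfl)
  simp [gapOne] at this

theorem pathSets_one : pathSets 1 = {{0}} := by
  ext F
  simp only [pathSets, Set.mem_ofPred_eq, Set.mem_singleton_iff]
  constructor
  · rintro ⟨h1, h2, -⟩
    ext i
    have : i ∈ F → i < 1 := fun h => h1 h
    grind
  · rintro rfl
    refine ⟨?_, ?_⟩ <;> grind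

theorem pathSets_two : pathSets 2 = {{0, 1}} := by
  ext F
  simp only [pathSets, Set.mem_ofPred_eq, Set.mem_singleton_iff]
  constructor
  · rintro ⟨h1, h2, h3, -⟩
    ext i
    have : i ∈ F → i < 2 := fun h => h1 h
    grind
  · rintro rfl
    refine ⟨?_, ?_⟩ <;> grind

theorem pathSets_three : pathSets 3 = {{0, 2}} := by
  ext F
  simp only [pathSets, Set.mem_ofPred_eq, Set.mem_singleton_iff]
  constructor
  · rintro ⟨h1, h2, h3, -, h5⟩
    ext i
    have : i ∈ F → i < 3 := fun h => h1 h
    have := h5 0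
    grind
  · rintro rfl
    refine ⟨?_, ?_⟩ <;> grind

theorem isFort_pathGraph_iff {n : ℕ} (hn : 1 ≤ n) (F : Set (Fin n)) :
    IsFort (SimpleGraph.pathGraph n) F ↔ 0 ∈ Fin.val '' F ∧ n - 1 ∈ Fin.val '' F ∧
      ∀ i, i + 1 < n → i ∈ Fin.val '' F ∨ i + 1 ∈ Fin.val '' F := by
  have hmem (i : ℕ) : i ∈ Fin.val '' F ↔ ∃ h : i < n, ⟨i, h⟩ ∈ F := by
    constructor
    · rintro ⟨j, hj, rfl⟩; exact ⟨j.2, hj⟩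
    · rintro ⟨h, hi⟩; exact ⟨_, hi, rfl⟩
  have hfort : IsFort (SimpleGraph.pathGraph n) F ↔ (Fin.val '' F).Nonempty ∧
      (∀ i, i < n → i ∉ Fin.val '' F → (i + 1 ∈ Fin.val '' F ↔ 0 < i ∧ i - 1 ∈ Fin.val '' F)) := by
    rw [isFort_iff, Set.image_nonempty]
    refine and_congr_right fun _ => ?_
    simp only [hmem, SimpleGraph.pathGraph_adj]
    constructor
    · intro h i hi hiF
      constructor
      · rintro ⟨h1, h2⟩
        obtain ⟨b, hb, hne, hadj⟩ := h ⟨i, hi⟩ (fun h => hiF ⟨hi, h⟩) _ h2 (.inl rfl)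
        have : b.val ≠ i + 1 := fun h => hne (Fin.ext h)
        have hb' : b.val + 1 = i := by simp only at hadj; omega
        refine ⟨by omega, by omega, ?_⟩
        convert hb
        omega
      · rintro ⟨h0, h1, h2⟩
        obtain ⟨b, hb, hne, hadj⟩ := h ⟨i, hi⟩ (fun h => hiF ⟨hi, h⟩) _ h2
          (.inr (Nat.sub_add_cancel h0))
        have : b.val ≠ i - 1 := fun h => hne (Fin.ext h)
        have hb' : i + 1 = b.val := by simp only at hadj; omega
        refine ⟨by omega, ?_⟩
        convert hb
    · intro h v hv a ha hva
      have hv' := h v v.2 (fun h => hv h.2)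
      rcases hva with hva | hva
      · obtain ⟨h0, h1, h2⟩ := hv'.1 ⟨hva ▸ a.2, by convert ha⟩
        refine ⟨_, h2, fun h => ?_, .inr ?_⟩
        · have := congrArg Fin.val h
          simp only at this; omega
        · simp only; omega
      · obtain ⟨h1, h2⟩ := hv'.2 ⟨by omega, by omega, by convert ha; omega⟩
        refine ⟨_, h2, fun h => ?_, .inl rfl⟩
        have := congrArg Fin.val h
        simp only at this; omega
  rw [hfort]
  have hlt : ∀ i ∈ Fin.val '' F, i < n := fun i hi => ((hmem i).1 hi).1
  generalize Fin.val '' F = S at *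
  clear hfort hmem
  constructor
  · rintro ⟨hne, h⟩
    -- Two consecutive gaps propagate in both directions, since the next vertex would be the sole
    -- fort neighbour of a gap; the fort would be empty.
    have fwd (i : ℕ) (h0 : i ∉ S) (h1 : i + 1 ∉ S) (j : ℕ) : i + j ∉ S ∧ i + j + 1 ∉ S := by
      induction j with
      | zero => exact ⟨h0, h1⟩
      | succ j ih =>
        refine ⟨ih.2, fun hs => ?_⟩
        have hl := hlt _ hs
        have := (h (i + (j + 1)) (by omega) ih.2).1 hs
        exact ih.1 (by simpa [← add_assoc] using this.2)
    have bwd (i : ℕ) (h0 : i ∉ S) (h1 : i + 1 ∉ S) (hi : i < n) (j : ℕ) (hj : j ≤ i) :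
        i - j ∉ S ∧ i - j + 1 ∉ S := by
      induction j with
      | zero => exact ⟨h0, h1⟩
      | succ j ih =>
        obtain ⟨ih0, ih1⟩ := ih (by omega)
        have e : i - (j + 1) + 1 = i - j := by omega
        rw [e]
        refine ⟨fun hs => ih1 ?_, ih0⟩
        exact (h (i - j) (by omega) ih0).2 ⟨by omega, by rwa [show i - j - 1 = i - (j + 1) by omega]⟩
    have all (i : ℕ) (h0 : i ∉ S) (h1 : i + 1 ∉ S) (hi : i < n) : False := by
      obtain ⟨m, hm⟩ := hne
      rcases le_total i m with h | h
      · exact (fwd i h0 h1 (m - i)).1 (by rwa [Nat.add_sub_cancel' h])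
      · exact (bwd i h0 h1 hi (i - m) (by omega)).1 (by rwa [Nat.sub_sub_self h])
    refine ⟨?_, ?_, fun i hi => ?_⟩
    · by_contra h0
      exact all 0 h0 (fun h1 => by simpa using (h 0 hn h0).1 h1) hn
    · by_contra h0
      refine all (n - 1) h0 (fun h1 => ?_) (by omega)
      have := hlt _ h1
      omega
    · by_contra! hi'
      exact all i hi'.1 hi'.2 (by omega)
  · rintro ⟨h0, h1, h2⟩
    refine ⟨⟨0, h0⟩, fun i hi hiS => ?_⟩
    have hi0 : i ≠ 0 := fun h => hiS (h ▸ h0)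
    have hi1 : i ≠ n - 1 := fun h => hiS (h ▸ h1)
    have a := (h2 i (by omega)).resolve_left hiS
    have b := (h2 (i - 1) (by omega)).resolve_right (by rwa [Nat.sub_add_cancel (by omega)])
    exact ⟨fun _ => ⟨by omega, b⟩, fun _ => a⟩

theorem minimal_isFort_pathGraph_iff {n : ℕ} (hn : 1 ≤ n) (F : Set (Fin n)) :
    Minimal (IsFort (SimpleGraph.pathGraph n)) F ↔ Fin.val '' F ∈ pathSets n := by
  have hlt (F : Set (Fin n)) : Fin.val '' F ⊆ Set.Iio n := by
    rintro _ ⟨i, -, rfl⟩; exact i.2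
  constructor
  · intro hF
    obtain ⟨h1, h2, h3⟩ := (isFort_pathGraph_iff hn F).1 hF.1
    refine ⟨hlt F, h1, h2, h3, ?_⟩
    rintro i hi hi1 hi2
    have hin := hlt F hi2
    simp only [Set.mem_Iio] at hin
    -- The middle of three consecutive members can be dropped: only a single gap appears, away from
    -- the ends.
    have hfort : IsFort (SimpleGraph.pathGraph n) (F \ {⟨i + 1, by omega⟩}) := by
      rw [isFort_pathGraph_iff hn, Set.image_sdiff Fin.val_injective, Set.image_singleton]
      simp only [Set.mem_sdiff, Set.mem_singleton_iff]
      refine ⟨⟨h1, by omega⟩, ⟨h2, by omega⟩, fun j hj => ?_⟩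
      by_cases e1 : j = i + 1
      · subst e1; exact .inr ⟨hi2, by omega⟩
      · by_cases e2 : j = i
        · subst e2; exact .inl ⟨hi, by omega⟩
        · exact (h3 j hj).imp (⟨·, e1⟩) (⟨·, by omega⟩)
    obtain ⟨v, hv, hvi⟩ := hi1
    exact (hF.2 hfort Set.sdiff_subset hv).2 (Fin.ext hvi)
  · rintro ⟨-, h1, h2, h3, h4⟩
    refine ⟨(isFort_pathGraph_iff hn F).2 ⟨h1, h2, h3⟩, fun F' hF' hsub v hv => ?_⟩
    obtain ⟨k1, k2, k3⟩ := (isFort_pathGraph_iff hn F').1 hF'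
    have hsub' : Fin.val '' F' ⊆ Fin.val '' F := Set.image_mono hsub
    suffices h : v.val ∈ Fin.val '' F' by
      obtain ⟨w, hw, hwv⟩ := h
      exact Fin.ext hwv ▸ hw
    by_contra hvF
    have e0 : v.val ≠ 0 := fun h => hvF (h ▸ k1)
    have e1 : v.val ≠ n - 1 := fun h => hvF (h ▸ k2)
    have hv2 := v.2
    obtain ⟨i, hi⟩ : ∃ i, v.val = i + 1 := ⟨v.val - 1, by omega⟩
    rw [hi] at hvF
    exact h4 i (hsub' ((k3 i (by omega)).resolve_right hvF)) (hi ▸ ⟨v, hv, rfl⟩)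
      (hsub' ((k3 (i + 1) (by omega)).resolve_left hvF))

theorem pathCount_eq {n : ℕ} (hn : 1 ≤ n) : pathCount n = (pathSets n).ncard := by
  rw [pathCount, numMinimalForts,
    ← Set.ncard_image_of_injective _ (Set.image_injective.2 (Fin.val_injective (n := n)))]
  congr 1
  ext F
  constructor
  · rintro ⟨F, hF, rfl⟩
    exact (minimal_isFort_pathGraph_iff hn F).1 hF
  · intro hF
    have : Fin.val '' (Fin.val ⁻¹' F : Set (Fin n)) = F := by
      rw [Set.image_preimage_eq_of_subset]
      rw [Fin.range_val]
      exact hF.1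
    exact ⟨Fin.val ⁻¹' F, (minimal_isFort_pathGraph_iff hn _).2 (by rwa [this]), this⟩

theorem pathCount_one : pathCount 1 = 1 := by
  rw [pathCount_eq le_rfl, pathSets_one, Set.ncard_singleton]

theorem pathCount_two : pathCount 2 = 1 := by
  rw [pathCount_eq (by norm_num), pathSets_two, Set.ncard_singleton]

theorem pathCount_three : pathCount 3 = 1 := by
  rw [pathCount_eq (by norm_num), pathSets_three, Set.ncard_singleton]

theorem pathCount_add_three {n : ℕ} (hn : 1 ≤ n) :
    pathCount (n + 3) = pathCount (n + 1) + pathCount n := by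
  rw [pathCount_eq (by omega), pathCount_eq (by omega), pathCount_eq hn,
    ncard_pathSets_add_three hn]

/-! ### Comparison with the path and double counting -/

/-- Both sides obey the same recurrence; the factor `2` absorbs the initial values `1, r, r ^ 2`. -/
theorem pow_le_two_mul_pathCount {r : ℝ} (hr : r ^ 3 = r + 1) (h0 : 0 ≤ r) (h2 : r ^ 2 ≤ 2) (n : ℕ) :
    r ^ n ≤ 2 * pathCount (n + 1) := by
  induction n using Nat.strong_induction_on with
  | _ n ih =>
    match n with
    | 0 => simp [pathCount_one]
    | 1 =>
      rw [show 1 + 1 = 2 from rfl, pathCount_two]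
      push_cast
      nlinarith
    | 2 =>
      rw [show 2 + 1 = 3 from rfl, pathCount_three]
      push_cast
      linarith
    | n + 3 =>
      have := ih n (by omega)
      have := ih (n + 1) (by omega)
      rw [show n + 3 + 1 = n + 1 + 3 by ring, pathCount_add_three (by omega), pow_add, hr]
      push_cast
      rw [pow_succ] at this
      linarith

theorem ncard_minimal_mem_le_pathCount {n : ℕ} (hn : 1 ≤ n) {G : SimpleGraph (Fin n)}
    (hG : G.IsAcyclic) (x : Fin n) :
    {F | Minimal (IsFort G) F ∧ x ∈ F}.ncard ≤ 2 * pathCount n := by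
  obtain ⟨r, hr, h1, h2⟩ := exists_plastic
  obtain ⟨m, rfl⟩ : ∃ m, n = m + 1 := ⟨n - 1, by omega⟩
  have h := ncard_minimal_mem_le hr h1 hG x
  rw [Nat.card_fin, pow_succ'] at h
  have := (le_of_mul_le_mul_left h (by linarith)).trans
    (pow_le_two_mul_pathCount hr (by linarith) (by nlinarith) m)
  exact_mod_cast this

theorem one_le_pathCount (n : ℕ) : 1 ≤ pathCount (n + 1) := by
  induction n using Nat.strong_induction_on with
  | _ n ih =>
    match n with
    | 0 => exact pathCount_one.ge
    | 1 => exact pathCount_two.ge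
    | 2 => exact pathCount_three.ge
    | n + 3 =>
      rw [show n + 3 + 1 = n + 1 + 3 by ring, pathCount_add_three (by omega)]
      exact (ih n (by omega)).trans (Nat.le_add_left _ _)

open Classical in
theorem two_mul_numMinimalForts_le {V : Type*} [Fintype V] (G : SimpleGraph V) {m : ℕ} (hm : 2 ≤ m)
    (h : ∀ x : V, {F | Minimal (IsFort G) F ∧ x ∈ F}.ncard ≤ m) :
    2 * numMinimalForts G ≤ Fintype.card V * m := by
  let M : Finset (Set V) := {F | Minimal (IsFort G) F}
  have hM : numMinimalForts G = M.card := by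
    rw [numMinimalForts, ← Set.ncard_coe_finset]
    simp [M]
  -- Singletons get an extra unit of weight, so that every minimal fort weighs at least two.
  have hpt (F : Set V) (hF : F ∈ M) :
      2 ≤ ∑ x : V, ((if x ∈ F then 1 else 0) + if F = {x} then 1 else 0) := by
    have hne : F.Nonempty := (Finset.mem_filter.1 hF).2.1.1
    obtain ⟨a, ha⟩ := hne
    by_cases hs : F = {a}
    · calc 2 ≤ (if a ∈ F then 1 else 0) + if F = {a} then 1 else 0 := by simp [ha, ← hs]
        _ ≤ _ := Finset.single_le_sum
          (f := fun x => (if x ∈ F then 1 else 0) + if F = {x} then 1 else 0)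
          (fun _ _ => Nat.zero_le _) (Finset.mem_univ a)
    · obtain ⟨b, hb, hab⟩ : ∃ b ∈ F, b ≠ a := by
        by_contra! hb
        exact hs (Set.eq_singleton_iff_unique_mem.2 ⟨ha, hb⟩)
      calc 2 = ∑ x ∈ ({a, b} : Finset V), 1 := by simp [hab.symm]
        _ ≤ ∑ x ∈ ({a, b} : Finset V), ((if x ∈ F then 1 else 0) + if F = {x} then 1 else 0) := by
          refine Finset.sum_le_sum fun x hx => ?_
          have : x ∈ F := by
            rcases Finset.mem_insert.1 hx with rfl | hx
            · exact ha
            · exact Finset.mem_singleton.1 hx ▸ hb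
          simp [this]
        _ ≤ _ := Finset.sum_le_sum_of_subset (Finset.subset_univ _)
  have hcol (x : V) :
      ∑ F ∈ M, ((if x ∈ F then 1 else 0) + if F = {x} then 1 else 0) ≤ m := by
    -- If `{x}` is a minimal fort, no other minimal fort contains `x`, so the total at `x` is `2`;
    -- this is where `2 ≤ m` enters.
    by_cases hx : {x} ∈ M
    · have hmin : Minimal (IsFort G) {x} := (Finset.mem_filter.1 hx).2
      refine le_trans ?_ hm
      calc _ = ∑ F ∈ M, if F = {x} then 2 else 0 := by
            refine Finset.sum_congr rfl fun F hF => ?_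
            have hF' : Minimal (IsFort G) F := (Finset.mem_filter.1 hF).2
            by_cases hxF : x ∈ F
            · have hsub : {x} ⊆ F := by simpa using hxF
              have : F = {x} := Set.Subset.antisymm (hF'.2 hmin.1 hsub) hsub
              simp [this]
            · have : F ≠ {x} := by rintro rfl; exact hxF rfl
              simp [this, hxF]
        _ ≤ 2 := by rw [Finset.sum_ite_eq' M {x}]; split_ifs ; simp
    · calc _ = ∑ F ∈ M, if x ∈ F then 1 else 0 := by
            refine Finset.sum_congr rfl fun F hF => ?_
            have : F ≠ {x} := by rintro rfl; exact hx hF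
            simp [this]
        _ = {F | Minimal (IsFort G) F ∧ x ∈ F}.ncard := by
            rw [← Finset.card_filter, ← Set.ncard_coe_finset]
            simp [M]
        _ ≤ m := h x
  calc 2 * numMinimalForts G = ∑ F ∈ M, 2 := by simp [hM, mul_comm]
    _ ≤ ∑ F ∈ M, ∑ x : V, ((if x ∈ F then 1 else 0) + if F = {x} then 1 else 0) :=
      Finset.sum_le_sum hpt
    _ = ∑ x : V, ∑ F ∈ M, ((if x ∈ F then 1 else 0) + if F = {x} then 1 else 0) :=
      Finset.sum_comm
    _ ≤ ∑ x : V, m := Finset.sum_le_sum fun x _ => hcol x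
    _ = Fintype.card V * m := by simp

theorem numMinimalForts_le {n : ℕ} (hn : 3 ≤ n) {G : SimpleGraph (Fin n)} (hG : G.IsAcyclic) :
    numMinimalForts G ≤ n.choose 2 * pathCount n := by
  have hp : 1 ≤ pathCount n := by
    obtain ⟨m, rfl⟩ : ∃ m, n = m + 1 := ⟨n - 1, by omega⟩
    exact one_le_pathCount m
  -- Replacing `2` by `n - 1` is a pure weakening, made to produce the binomial coefficient.
  have h2 : 2 * pathCount n ≤ (n - 1) * pathCount n := Nat.mul_le_mul_right _ (by omega)
  have h := two_mul_numMinimalForts_le G (m := (n - 1) * pathCount n) (by omega)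
    fun x => (ncard_minimal_mem_le_pathCount (by omega) hG x).trans h2
  rw [Fintype.card_fin, ← mul_assoc, ← Nat.two_mul_div_two_of_even (Nat.even_mul_pred_self n),
    ← Nat.choose_two_right, mul_assoc] at h
  exact Nat.le_of_mul_le_mul_left h two_pos

end MinimalForts

theorem theorem1 :
    (∀ n : ℕ, 3 ≤ n →
      MinimalForts.maxTree n ≤ MinimalForts.maxForest n ∧
      MinimalForts.maxForest n ≤ n.choose 2 * MinimalForts.pathCount n) ∧
    (MinimalForts.pathCount 1 = 1 ∧ MinimalForts.pathCount 2 = 1 ∧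
      MinimalForts.pathCount 3 = 1 ∧
      ∀ n : ℕ, 4 ≤ n →
        MinimalForts.pathCount n =
          MinimalForts.pathCount (n - 2) + MinimalForts.pathCount (n - 3)) := by
  refine ⟨fun n hn => ⟨?_, ?_⟩, MinimalForts.pathCount_one, MinimalForts.pathCount_two,
    MinimalForts.pathCount_three, fun n hn => ?_⟩
  · obtain ⟨G, hG, h⟩ := (MinimalForts.isGreatest_maxTree (by omega : 1 ≤ n)).1
    exact (MinimalForts.isGreatest_maxForest n).2 ⟨G, hG.isAcyclic, h⟩
  · obtain ⟨G, hG, h⟩ := (MinimalForts.isGreatest_maxForest n).1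
    exact h ▸ MinimalForts.numMinimalForts_le hn hG
  · obtain ⟨m, rfl⟩ : ∃ m, n = m + 3 := ⟨n - 3, by omega⟩
    exact MinimalForts.pathCount_add_three (by omega)
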